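/- Let $L\ge 1$, $M\ge 2$, let $\boldsymbol\omega=(\omega_1,\dots,\omega_M)$ be a probability vector and $\mathbf K_X\in\mathbb R^{L\times L}$ a positive definite matrix. Let $S$ take values in $\{1,\dots,M\}$ with $\mathbb P\{S=\ell\}=\omega_\ell$, let $\boldsymbol X=(X_1,\dots,X_L)$ have conditional law $\mathcal N(\ell\cdot\boldsymbol 1,\mathbf K_X)$ given $S=\ell$, and assume that $X_1,\dots,X_L$ are conditionally independent given $S$ (i.e. $\mathbf K_X$ is diagonal). Let $(S_j,\boldsymbol X_j)_{j\ge1}$ be i.i.d. copies of $(S,\boldsymbol X)$. A block code of length $k\ge 1$ consists of $L$ (measurable) encoders $\varphi_i:\mathbb R^k\to\mathcal C_i$ with finite $\mathcal C_i$, where encoder $i$ is applied to $X_i^k=(X_{i,1},\dots,X_{i,k})$ only, and of decoders which map the message tuple in $\prod_i\mathcal C_i$ to a probability distribution on $\{1,\dots,M\}^k$, with $j$-th marginal $\hat S_j$, and to real sequences $\hat X_i^k$, $i=1,\dots,L$. Its sum rate is $\sum_{i=1}^L\frac1k\log_2|\mathcal C_i|$. For $D_S\ge0$ and $\boldsymbol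 D_X=(D_{X_1},\dots,D_{X_L})$ with $D_{X_i}\ge 0$, let $R^{\mathrm C}(D_S,\boldsymbol D_X)\in[0,+\infty]$ be the infimum, over all $k\ge1$ and all block codes of length $k$ with $$\mathbb E\Big[\frac1k\sum_{j=1}^k-\log_2\hat S_j(S_j)\Big]\le D_S,\qquad \mathbb E\Big[\frac1k\sum_{j=1}^k(X_{i,j}-\hat X_{i,j})^2\Big]\le D_{X_i}\quad(i=1,\dots,L),$$ of the sum rate ($+\infty$ if there is no such code). Then for every $D_S\ge 0$ (in particular whenever $H(S|\boldsymbol X)\le D_S\le H(\boldsymbol\omega)$) and all $0\le D_{X_i}\le \boldsymbol e_i^T\mathbf K_X\boldsymbol e_i$, $i=1,\dots,L$, $$R^{\mathrm C}(D_S,\boldsymbol D_X)\ \ge\ R^{\mathrm C}_{\mathrm{out}}(D_S,\boldsymbol D_X),$$ where $$R^{\mathrm C}_{\mathrm{out}}(D_S,\boldsymbol D_X)=\min_{\boldsymbol\Gamma}\Big\{H(\boldsymbol\omega)-\beta(\boldsymbol\Gamma)+\frac12\log_2\frac{\det\mathbf K_X}{\det\boldsymbol\Gamma}\Big\},$$ the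 minimum is over all symmetric $\boldsymbol\Gamma\in\mathbb R^{L\times L}$ with $\mathbf O\preceq\boldsymbol\Gamma\preceq\mathbf K_X$ and $\boldsymbol e_i^T\boldsymbol\Gamma\boldsymbol e_i\le D_{X_i}$ for all $i$, it is attained, and the objective is $+\infty$ when $\det\boldsymbol\Gamma=0$. Here $$H(\boldsymbol\omega)=-\sum_{\ell=1}^M\omega_\ell\log_2\omega_\ell,\qquad \beta(\boldsymbol\Gamma)=\min\{D_S,\ 1+\log_2(M-1)\,p_e(\boldsymbol\Gamma)\},$$ $$p_e(\boldsymbol\Gamma)=\min\Big\{1,\ \inf_{0<\alpha<\frac12}\Big\{2Q\Big(\frac{L\alpha}{\sqrt{\mathrm{tr}\,\mathbf K_X}}\Big)+\frac1L\Big(\frac12-\alpha\Big)^{-2}\mathrm{tr}\,\boldsymbol\Gamma\Big\}\Big\},$$ and $Q(x)=\mathbb P\{N>x\}$ for a standard normal variable $N$. -/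

import Mathlib

open MeasureTheory ProbabilityTheory
open scoped ENNReal NNReal

noncomputable section

namespace SemanticMT

/-! ### The source: a discrete label and its conditionally Gaussian observations -/

/-- The Gaussian law `N(ℓ·1, K)` of the observation vector given the label.
The element `s : Fin M` stands for the label `ℓ = s + 1 ∈ {1, …, M}`. -/
def obsLaw {L M : ℕ} (K : Matrix (Fin L) (Fin L) ℝ) (s : Fin M) :
    Measure (EuclideanSpace ℝ (Fin L)) :=
  multivariateGaussian (WithLp.toLp 2 fun _ => ((s : ℕ) : ℝ) + 1) K

/-- The joint law of one source symbol `(S, X)`: `P(S = ℓ) = ω ℓ`, `X | S = ℓ ∼ N(ℓ·1, K)`. -/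
def sourceLaw {L M : ℕ} (ω : Fin M → ℝ) (K : Matrix (Fin L) (Fin L) ℝ) :
    Measure (Fin M × EuclideanSpace ℝ (Fin L)) :=
  ∑ s : Fin M, ENNReal.ofReal (ω s) • (Measure.dirac s).prod (obsLaw K s)

/-- The joint law of a block of `k` i.i.d. source symbols. -/
def blockLaw {L M : ℕ} (k : ℕ) (ω : Fin M → ℝ) (K : Matrix (Fin L) (Fin L) ℝ) :
    Measure (Fin k → Fin M × EuclideanSpace ℝ (Fin L)) :=
  Measure.pi fun _ => sourceLaw ω K

/-- The observations `X_1, …, X_L` are conditionally independent given the label `S`,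
that is, `P(s, x) = P(s) ∏ᵢ P(xᵢ | s)`. -/
def CondIndepObs {L : ℕ} (M : ℕ) (K : Matrix (Fin L) (Fin L) ℝ) : Prop :=
  ∀ s : Fin M, iIndepFun (fun (i : Fin L) (x : EuclideanSpace ℝ (Fin L)) => x i) (obsLaw K s)

/-! ### Block codes, distortions and the operational sum-rate-distortion function -/

/-- A block code of length `k` with `L` separate encoders: encoder `i` sees only `X_i^k` and sends
one of `size i` messages; the joint decoder outputs a probability distribution on label sequences
and a real reconstruction sequence for each observation. -/
structure Code (L M k : ℕ) where
  /-- number of messages of each encoder -/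
  size : Fin L → ℕ
  /-- the encoders -/
  enc : ∀ i : Fin L, (Fin k → ℝ) → Fin (size i)
  measurable_enc : ∀ i, Measurable (enc i)
  /-- the semantic decoder -/
  decS : (∀ i : Fin L, Fin (size i)) → PMF (Fin k → Fin M)
  /-- the observation decoders -/
  decX : Fin L → (∀ i : Fin L, Fin (size i)) → Fin k → ℝ

/-- Logarithmic loss `-log₂ q(s)`, with value `∞` when `q(s) = 0`. -/
def logLoss {M : ℕ} (s : Fin M) (q : PMF (Fin M)) : ℝ≥0∞ :=
  if q s = 0 then ⊤ else ENNReal.ofReal (-Real.logb 2 (q s).toReal)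

/-- Squared error. -/
def sqLoss (x y : ℝ) : ℝ≥0∞ := ENNReal.ofReal ((x - y) ^ 2)

namespace Code

variable {L M k : ℕ}

/-- Sum rate `∑ᵢ (1/k) log₂ |Cᵢ|` in bits per source symbol. -/
def sumRate (c : Code L M k) : ℝ := ∑ i, (1 / (k : ℝ)) * Real.logb 2 (c.size i)

/-- The tuple of messages sent for a block of source symbols. -/
def message (c : Code L M k) (z : Fin k → Fin M × EuclideanSpace ℝ (Fin L)) :
    ∀ i : Fin L, Fin (c.size i) :=
  fun i => c.enc i fun j => (z j).2 i

/-- The reconstruction of the `j`-th label: the `j`-th marginal of the decoded distribution. -/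
def softLabel (c : Code L M k) (m : ∀ i : Fin L, Fin (c.size i)) (j : Fin k) : PMF (Fin M) :=
  (c.decS m).map fun s => s j

/-- Expected block-averaged semantic distortion (log loss). -/
def semDist (c : Code L M k) (ω : Fin M → ℝ) (K : Matrix (Fin L) (Fin L) ℝ) : ℝ≥0∞ :=
  ∫⁻ z, (k : ℝ≥0∞)⁻¹ * ∑ j, logLoss (z j).1 (c.softLabel (c.message z) j) ∂(blockLaw k ω K)

/-- Expected block-averaged distortion (squared error) of the `i`-th observation. -/
def obsDist (c : Code L M k) (ω : Fin M → ℝ) (K : Matrix (Fin L) (Fin L) ℝ) (i : Fin L) : ℝ≥0∞ :=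
  ∫⁻ z, (k : ℝ≥0∞)⁻¹ * ∑ j, sqLoss ((z j).2 i) (c.decX i (c.message z) j) ∂(blockLaw k ω K)

end Code

/-- `(R, D_S, D_X)` is admissible at block length `k`. -/
def Admissible {L M : ℕ} (ω : Fin M → ℝ) (K : Matrix (Fin L) (Fin L) ℝ) (k : ℕ)
    (R : ℝ) (DS : ℝ≥0) (DX : Fin L → ℝ≥0) : Prop :=
  ∃ c : Code L M k, c.sumRate = R ∧ c.semDist ω K ≤ DS ∧ ∀ i, c.obsDist ω K i ≤ DX i

/-- The sum-rate-distortion function: the infimum of the admissible sum rates over all block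
lengths `k ≥ 1` (`+∞` if there are none). -/
def rateDistortion {L M : ℕ} (ω : Fin M → ℝ) (K : Matrix (Fin L) (Fin L) ℝ)
    (DS : ℝ≥0) (DX : Fin L → ℝ≥0) : EReal :=
  sInf {r : EReal | ∃ k : ℕ, 1 ≤ k ∧ ∃ R : ℝ, Admissible ω K k R DS DX ∧ r = (R : EReal)}

/-! ### The outer bound -/

/-- Entropy in bits. -/
def entropy {M : ℕ} (ω : Fin M → ℝ) : ℝ := -∑ s, ω s * Real.logb 2 (ω s)

/-- The tail probability of the standard normal law. -/
def Qfun (x : ℝ) : ℝ := (gaussianReal 0 1).real (Set.Ioi x)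

/-- `p_e(Γ)`; the minimum over the open interval `0 < α < 1/2` is read as an infimum. -/
def pe {L : ℕ} (K Γ : Matrix (Fin L) (Fin L) ℝ) : ℝ :=
  min 1 (⨅ α : Set.Ioo (0 : ℝ) (1 / 2),
    (2 * Qfun ((L : ℝ) * (α : ℝ) / Real.sqrt K.trace)
      + 1 / (L : ℝ) * ((1 / 2 - (α : ℝ)) ^ 2)⁻¹ * Γ.trace))

/-- `β(Γ) = min {D_S, 1 + log₂(M-1) p_e(Γ)}`. -/
def beta {L : ℕ} (M : ℕ) (K : Matrix (Fin L) (Fin L) ℝ) (DS : ℝ≥0)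
    (Γ : Matrix (Fin L) (Fin L) ℝ) : ℝ :=
  min (DS : ℝ) (1 + Real.logb 2 ((M : ℝ) - 1) * pe K Γ)

/-- The constraints `0 ⪯ Γ ⪯ K` and `Γᵢᵢ ≤ D_{X_i}`. -/
def feasible {L : ℕ} (K : Matrix (Fin L) (Fin L) ℝ) (DX : Fin L → ℝ≥0) :
    Set (Matrix (Fin L) (Fin L) ℝ) :=
  {Γ | Γ.PosSemidef ∧ (K - Γ).PosSemidef ∧ ∀ i, Γ i i ≤ DX i}

/-- The objective `H(ω) - β(Γ) + ½ log₂ (det K / det Γ)`, equal to `+∞` for singular `Γ`. -/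
def objective {L M : ℕ} (ω : Fin M → ℝ) (K : Matrix (Fin L) (Fin L) ℝ) (DS : ℝ≥0)
    (Γ : Matrix (Fin L) (Fin L) ℝ) : EReal :=
  if Γ.det = 0 then ⊤
  else ((entropy ω - beta M K DS Γ + 1 / 2 * Real.logb 2 (K.det / Γ.det) : ℝ) : EReal)

/-- The outer bound: the optimal value of the objective over the feasible matrices. -/
def rateOut {L M : ℕ} (ω : Fin M → ℝ) (K : Matrix (Fin L) (Fin L) ℝ)
    (DS : ℝ≥0) (DX : Fin L → ℝ≥0) : EReal :=
  sInf (objective ω K DS '' feasible K DX)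

end SemanticMT

end

/-!
# An outer bound for the semantic sum-rate-distortion function

Conditionally independent jointly Gaussian observations have a diagonal covariance `K`, so
`diag(DX)` is feasible. It has the largest trace of all feasible matrices and, by Hadamard's
inequality (`det_le_prod_of_diag_le`), the largest determinant; hence it minimises the objective
(`objective_distMatrix_le`), and the minimum is attained there. If some `DX i` vanishes, the value
is `+∞`.

It remains to bound the rate of a code from below by the objective at `diag(DX)`. Fix a code with
message tuple `W`. For each value `w` let `T w` be the likelihood ratio, on a block, of the law
"labels independent with masses `q w j`, observations independent `N(x̂ᵢⱼ(w), Dᵢ)`" to the source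
law. It has mean at most one, so by Jensen's inequality `E log T_W` is at most the log of the number
of messages (`integral_log_selected_le`). Expanding the logarithm, the Gaussian quadratic terms
contribute at least zero by the distortion constraints, and what is left is
`k H(ω) + (k/2) ∑ᵢ log (Kᵢᵢ / Dᵢ)` minus the expected log loss of `q`
(`Code.log_card_message_ge`). No entropies of continuous variables are needed.

The two terms of `β` come from two choices of `q`. The decoder's soft labels have log loss at most
`D_S` (`Code.sumRate_ge_of_semDist`). Mass `1/2` on an estimate of the label and the rest shared
equally gives Fano's bound `1 + log₂ (M - 1) Pₑ` (`Code.sumRate_ge_of_error`). For the estimate take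
the label nearest to the mean of the reconstructions: an error forces either the mean of the
observations to deviate from the label by more than `α`, a Gaussian tail event, or the mean of the
reconstructions to deviate from it by at least `1/2 - α`, so that `Pₑ ≤ pₑ(diag(DX))`
(`Code.sum_error_le`). The case `DX i = 0` is excluded by letting the distortion tend to zero in the
first bound (`Code.distortion_ne_zero`).
-/

namespace SemanticMT

/-! ### The source law -/

section Source

variable {L M : ℕ} {ω : Fin M → ℝ} {K : Matrix (Fin L) (Fin L) ℝ}

instance isGaussian_obsLaw (s : Fin M) : IsGaussian (obsLaw K s) := by
  unfold obsLaw; infer_instance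

lemma lintegral_sourceLaw {f : Fin M × EuclideanSpace ℝ (Fin L) → ℝ≥0∞} (hf : Measurable f) :
    ∫⁻ z, f z ∂(sourceLaw ω K)
      = ∑ s, ENNReal.ofReal (ω s) * ∫⁻ x, f (s, x) ∂(obsLaw K s) := by
  unfold sourceLaw
  rw [lintegral_finsetSum_measure]
  refine Finset.sum_congr rfl fun s _ => ?_
  rw [lintegral_smul_measure, Measure.dirac_prod, lintegral_map hf (by fun_prop), smul_eq_mul]

lemma isProbabilityMeasure_sourceLaw (hω : ∀ s, 0 ≤ ω s) (hω1 : ∑ s, ω s = 1) :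
    IsProbabilityMeasure (sourceLaw ω K) := by
  constructor
  have h := lintegral_sourceLaw (ω := ω) (K := K) (f := fun _ => 1) measurable_const
  rw [lintegral_one] at h
  rw [h]
  simp [← ENNReal.ofReal_sum_of_nonneg fun s _ => hω s, hω1]

lemma ae_label_pos : ∀ᵐ z ∂(sourceLaw ω K), 0 < ω z.1 := by
  have hm : MeasurableSet {z : Fin M × EuclideanSpace ℝ (Fin L) | ¬ 0 < ω z.1} :=
    measurable_fst (MeasurableSet.of_discrete (s := {s : Fin M | ¬ 0 < ω s}))
  rw [ae_iff, ← lintegral_indicator_one hm, lintegral_sourceLaw (measurable_one.indicator hm)]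
  refine Finset.sum_eq_zero fun s _ => ?_
  simp [Set.indicator]

lemma measurePreserving_obsLaw (hK : K.PosSemidef) (s : Fin M) (i : Fin L) :
    MeasurePreserving (fun x : EuclideanSpace ℝ (Fin L) => x i) (obsLaw K s)
      (gaussianReal ((s : ℕ) + 1) (K i i).toNNReal) :=
  measurePreserving_eval_multivariateGaussian hK

lemma memLp_coord (s : Fin M) (i : Fin L) :
    MemLp (fun x : EuclideanSpace ℝ (Fin L) => x i) 2 (obsLaw K s) :=
  (IsGaussian.memLp_two_id (μ := obsLaw K s)).continuousLinearMap_comp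
    (EuclideanSpace.proj i : EuclideanSpace ℝ (Fin L) →L[ℝ] ℝ)

/-- Conditionally independent jointly Gaussian coordinates are conditionally uncorrelated, so
`K` is diagonal; the label set must be nonempty for the hypothesis to say anything. -/
lemma eq_diagonal_of_condIndepObs (hM : 0 < M) (hK : K.PosSemidef) (hind : CondIndepObs M K) :
    K = Matrix.diagonal fun i => K i i := by
  ext i j
  rcases eq_or_ne i j with rfl | hij
  · simp
  · rw [Matrix.diagonal_apply_ne _ hij]
    have h := ((hind ⟨0, hM⟩).indepFun hij).covariance_eq_zero (memLp_coord _ i) (memLp_coord _ j)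
    rwa [obsLaw, covariance_eval_multivariateGaussian hK] at h

lemma lintegral_prod_obsLaw (hK : K.PosSemidef) (hind : CondIndepObs M K) (s : Fin M)
    {g : Fin L → ℝ → ℝ≥0∞} (hg : ∀ i, Measurable (g i)) :
    ∫⁻ x, ∏ i, g i (x i) ∂(obsLaw K s)
      = ∏ i, ∫⁻ y, g i y ∂(gaussianReal ((s : ℕ) + 1) (K i i).toNNReal) := by
  have h := lintegral_prod_eq_prod_lintegral_of_indepFun Finset.univ _ ((hind s).comp g hg)
    (fun i => (hg i).comp (by fun_prop))
  simp only [Function.comp_apply] at h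
  rw [h]
  exact Finset.prod_congr rfl fun i _ => (measurePreserving_obsLaw hK s i).lintegral_comp (hg i)

/-- Integrating a likelihood ratio of two Gaussian densities against the denominator. -/
lemma lintegral_gaussianPDFReal_div (a m : ℝ) {d v : ℝ≥0} (hd : d ≠ 0) (hv : v ≠ 0) :
    ∫⁻ x, ENNReal.ofReal (gaussianPDFReal a d x / gaussianPDFReal m v x) ∂(gaussianReal m v)
      = 1 := by
  rw [gaussianReal_of_var_ne_zero _ hv,
    lintegral_withDensity_eq_lintegral_mul _ (measurable_gaussianPDF m v)
      (g := fun x => ENNReal.ofReal (gaussianPDFReal a d x / gaussianPDFReal m v x))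
      (((measurable_gaussianPDFReal a d).div (measurable_gaussianPDFReal m v)).ennreal_ofReal),
    ← lintegral_gaussianPDF_eq_one a hd]
  refine lintegral_congr fun x => ?_
  have h := gaussianPDFReal_pos m v x hv
  rw [Pi.mul_apply, gaussianPDF, gaussianPDF, ← ENNReal.ofReal_mul h.le, mul_div_cancel₀ _ h.ne']

lemma lintegral_sq_sub_label (hω : ∀ s, 0 ≤ ω s) (hω1 : ∑ s, ω s = 1) (hK : K.PosSemidef)
    (i : Fin L) :
    ∫⁻ z, ENNReal.ofReal ((z.2 i - ((z.1 : ℕ) + 1 : ℝ)) ^ 2) ∂(sourceLaw ω K)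
      = ENNReal.ofReal (K i i) := by
  rw [lintegral_sourceLaw]
  · have h : ∀ s : Fin M,
        ∫⁻ x, ENNReal.ofReal ((x i - ((s : ℕ) + 1 : ℝ)) ^ 2) ∂(obsLaw K s)
          = ENNReal.ofReal (K i i) := by
      intro s
      have hmp := measurePreserving_obsLaw hK s i
      have hm : ∫ x, x i ∂(obsLaw K s) = (s : ℕ) + 1 := by
        rw [← integral_map (φ := fun x : EuclideanSpace ℝ (Fin L) => x i) (f := fun y : ℝ => y)
          hmp.measurable.aemeasurable (by fun_prop), hmp.map_eq]
        simp
      rw [← variance_eval_multivariateGaussian (μ := WithLp.toLp 2 fun _ => ((s : ℕ) : ℝ) + 1) hK i]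
      change _ = ENNReal.ofReal (variance (fun x : EuclideanSpace ℝ (Fin L) => x i) (obsLaw K s))
      rw [(memLp_coord s i).ofReal_variance_eq, evariance_eq_lintegral_ofReal, hm]
    simp only [h, ← Finset.sum_mul]
    rw [← ENNReal.ofReal_sum_of_nonneg fun s _ => hω s, hω1]
    simp
  · refine Measurable.ennreal_ofReal (Measurable.pow_const (Measurable.sub (by fun_prop) ?_) 2)
    exact (Measurable.of_discrete (f := fun s : Fin M => ((s : ℕ) + 1 : ℝ))).comp measurable_fst

lemma gaussianReal_two_sided_tail {v : ℝ≥0} (hv : v ≠ 0) (a : ℝ) :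
    gaussianReal 0 v {x | a < |x|} ≤ ENNReal.ofReal (2 * Qfun (a / √v)) := by
  have hs : 0 < √(v : ℝ) := Real.sqrt_pos.2 (by positivity)
  have hmap : gaussianReal 0 v = (gaussianReal 0 1).map (fun x => √(v : ℝ) * x) := by
    rw [gaussianReal_map_const_mul]
    congr 1
    · simp
    · ext; simp
  have hpos : gaussianReal 0 v (Set.Ioi a) = ENNReal.ofReal (Qfun (a / √v)) := by
    rw [hmap, Measure.map_apply (by fun_prop) measurableSet_Ioi, Qfun, ofReal_measureReal]
    congr 1
    ext x
    simp [div_lt_iff₀' hs]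
  have hneg : gaussianReal 0 v (Set.Iio (-a)) = gaussianReal 0 v (Set.Ioi a) := by
    conv_lhs => rw [← neg_zero, ← gaussianReal_map_neg,
      Measure.map_apply (by fun_prop) measurableSet_Iio]
    congr 1
    ext x
    simp
  have hsub : {x : ℝ | a < |x|} ⊆ Set.Ioi a ∪ Set.Iio (-a) := by
    intro x hx
    have hx' : a < |x| := hx
    rcases lt_abs.1 hx' with h | h
    · exact Or.inl h
    · exact Or.inr (by simpa using lt_neg_of_lt_neg h)
  have hQ : 0 ≤ Qfun (a / √v) := measureReal_nonneg
  calc gaussianReal 0 v {x | a < |x|} ≤ _ := measure_mono hsub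
    _ ≤ _ := measure_union_le _ _
    _ = ENNReal.ofReal (2 * Qfun (a / √v)) := by
      rw [hneg, hpos, ← ENNReal.ofReal_add hQ hQ, two_mul]

/-- Given the label, the centred mean of the observations is `N(0, tr K / L²)`. This is where the
diagonal form of `K` matters for the error probability. -/
lemma map_mean_obsLaw (hL : 1 ≤ L) (hK : K.PosDef) (hind : CondIndepObs M K) (s : Fin M) :
    (obsLaw K s).map (fun x => (∑ i, x i) / L - ((s : ℕ) + 1 : ℝ))
      = gaussianReal 0 (K.trace / L ^ 2).toNNReal := by
  have hL0 : (L : ℝ) ≠ 0 := by positivity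
  let T : StrongDual ℝ (EuclideanSpace ℝ (Fin L)) :=
    ∑ i, (EuclideanSpace.proj i : EuclideanSpace ℝ (Fin L) →L[ℝ] ℝ)
  have hT : ⇑T = ∑ i : Fin L, (fun x : EuclideanSpace ℝ (Fin L) => x i) := by
    ext x; simp [T]
  have hmean : ∫ x, T x ∂(obsLaw K s) = L * ((s : ℕ) + 1) := by
    rw [T.integral_comp_comm IsGaussian.integrable_fun_id, obsLaw,
      integral_id_multivariateGaussian]
    simp [T, mul_add]
  have hvar : Var[T; obsLaw K s] = K.trace := by
    rw [hT, IndepFun.variance_sum (fun i _ => memLp_coord s i)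
      (fun i _ j _ hij => (hind s).indepFun hij)]
    exact Finset.sum_congr rfl fun i _ => variance_eval_multivariateGaussian hK.posSemidef i
  have hmap := IsGaussian.map_eq_gaussianReal (μ := obsLaw K s) T
  rw [hmean, hvar] at hmap
  have hcomp : (fun x : EuclideanSpace ℝ (Fin L) => (∑ i, x i) / L - ((s : ℕ) + 1 : ℝ))
      = (fun y => y - ((s : ℕ) + 1 : ℝ)) ∘ (fun y => y / (L : ℝ)) ∘ T := by
    ext x; simp [T]
  rw [hcomp, ← Measure.map_map (by fun_prop) (by fun_prop),
    ← Measure.map_map (by fun_prop) (by fun_prop), hmap, gaussianReal_map_div_const,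
    gaussianReal_map_sub_const]
  congr 1
  · field_simp; simp
  · ext
    simp [hK.posSemidef.trace_nonneg, div_nonneg]

lemma sourceLaw_mean_tail (hL : 1 ≤ L) (hω : ∀ s, 0 ≤ ω s) (hω1 : ∑ s, ω s = 1)
    (hK : K.PosDef) (hind : CondIndepObs M K) (α : ℝ) :
    sourceLaw ω K {z | α < |(∑ i, z.2 i) / L - ((z.1 : ℕ) + 1 : ℝ)|}
      ≤ ENNReal.ofReal (2 * Qfun (L * α / √K.trace)) := by
  have hLpos : (0 : ℝ) < L := by exact_mod_cast hL
  have : Nonempty (Fin L) := ⟨⟨0, hL⟩⟩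
  have htr : 0 < K.trace := hK.trace_pos
  have hm : MeasurableSet {z : Fin M × EuclideanSpace ℝ (Fin L) |
      α < |(∑ i, z.2 i) / L - ((z.1 : ℕ) + 1 : ℝ)|} := by
    refine measurableSet_lt measurable_const (continuous_abs.measurable.comp
      (Measurable.sub (by fun_prop) ?_))
    exact (Measurable.of_discrete (f := fun s : Fin M => ((s : ℕ) + 1 : ℝ))).comp measurable_fst
  rw [← lintegral_indicator_one hm, lintegral_sourceLaw (measurable_one.indicator hm)]
  have h : ∀ s : Fin M, ∫⁻ x, Set.indicator {z : Fin M × EuclideanSpace ℝ (Fin L) |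
      α < |(∑ i, z.2 i) / L - ((z.1 : ℕ) + 1 : ℝ)|} 1 (s, x) ∂(obsLaw K s)
      ≤ ENNReal.ofReal (2 * Qfun (L * α / √K.trace)) := by
    intro s
    have hm' : MeasurableSet {y : ℝ | α < |y|} := measurableSet_lt measurable_const (by fun_prop)
    have hmeas : Measurable
        (fun x : EuclideanSpace ℝ (Fin L) => (∑ i, x i) / L - ((s : ℕ) + 1 : ℝ)) := by fun_prop
    have hrw : L * α / √K.trace = α / √((K.trace / L ^ 2).toNNReal : ℝ) := by
      rw [Real.coe_toNNReal _ (by positivity), Real.sqrt_div htr.le, Real.sqrt_sq hLpos.le]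
      field_simp
    rw [hrw]
    refine le_trans (le_of_eq ?_) (gaussianReal_two_sided_tail
      (v := (K.trace / L ^ 2).toNNReal) (by simpa using (by positivity : 0 < K.trace / L ^ 2)) α)
    rw [← map_mean_obsLaw hL hK hind s, Measure.map_apply hmeas hm',
      ← lintegral_indicator_one (hmeas hm')]
    rfl
  calc _ ≤ ∑ s, ENNReal.ofReal (ω s) * ENNReal.ofReal (2 * Qfun (L * α / √K.trace)) :=
        Finset.sum_le_sum fun s _ => by gcongr; exact h s
    _ = _ := by
        rw [← Finset.sum_mul, ← ENNReal.ofReal_sum_of_nonneg fun s _ => hω s, hω1]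
        simp

end Source

/-! ### The change-of-measure bound -/

section ChangeOfMeasure

/-- Let `T w` be nonnegative with expectation at most one for each of finitely many messages `w`.
Even when the message is chosen as a function of the outcome, the expected logarithm of the chosen
`T` is at most the log of the number of messages: the chosen value is below the sum over all `w`,
and Jensen's inequality applies. -/
lemma integral_log_selected_le {Z W : Type*} [MeasurableSpace Z] [Fintype W] [Nonempty W]
    (μ : Measure Z) [IsProbabilityMeasure μ] (f : Z → W) (T : W → Z → ℝ)
    (hT : ∀ w z, 0 ≤ T w z) (hTm : ∀ w, Measurable (T w))
    (h1 : ∀ w, ∫⁻ z, ENNReal.ofReal (T w z) ∂μ ≤ 1) (hpos : ∀ᵐ z ∂μ, 0 < T (f z) z)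
    (hint : Integrable (fun z => Real.log (T (f z) z)) μ) :
    ∫ z, Real.log (T (f z) z) ∂μ ≤ Real.log (Fintype.card W) := by
  have hN : (0 : ℝ) < Fintype.card W := by exact_mod_cast Fintype.card_pos
  have hle : ∫⁻ z, ENNReal.ofReal (T (f z) z) ∂μ ≤ ENNReal.ofReal (Fintype.card W) := by
    calc ∫⁻ z, ENNReal.ofReal (T (f z) z) ∂μ
        ≤ ∫⁻ z, ∑ w, ENNReal.ofReal (T w z) ∂μ := lintegral_mono fun z =>
          Finset.single_le_sum (f := fun w => ENNReal.ofReal (T w z)) (fun _ _ => zero_le)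
            (Finset.mem_univ (f z))
      _ = ∑ w, ∫⁻ z, ENNReal.ofReal (T w z) ∂μ :=
          lintegral_finsetSum _ fun w _ => (hTm w).ennreal_ofReal
      _ ≤ ∑ _w : W, 1 := Finset.sum_le_sum fun w _ => h1 w
      _ = _ := by simp
  have hmeas : AEStronglyMeasurable (fun z => T (f z) z) μ := by
    refine (Real.measurable_exp.comp_aemeasurable
      hint.aemeasurable).aestronglyMeasurable.congr ?_
    filter_upwards [hpos] with z hz using Real.exp_log hz
  have hTint : Integrable (fun z => T (f z) z) μ := by
    refine ⟨hmeas, ?_⟩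
    rw [hasFiniteIntegral_iff_ofReal (.of_forall fun z => hT _ z)]
    exact hle.trans_lt ENNReal.ofReal_lt_top
  have hTle : ∫ z, T (f z) z ∂μ ≤ Fintype.card W := by
    rw [integral_eq_lintegral_of_nonneg_ae (.of_forall fun z => hT _ z) hmeas]
    exact ENNReal.toReal_le_of_le_ofReal hN.le hle
  -- Jensen's inequality through the tangent `log t ≤ t / N + log N - 1` of the logarithm at `N`.
  have hstep : ∫ z, Real.log (T (f z) z) ∂μ
      ≤ ∫ z, (T (f z) z / Fintype.card W + (Real.log (Fintype.card W) - 1)) ∂μ := by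
    refine integral_mono_ae hint ((hTint.div_const _).add (integrable_const _)) ?_
    filter_upwards [hpos] with z hz
    have h := Real.log_le_sub_one_of_pos (div_pos hz hN)
    rw [Real.log_div hz.ne' hN.ne'] at h
    linarith
  rw [integral_add (hTint.div_const _) (integrable_const _), integral_div, integral_const] at hstep
  have : (∫ z, T (f z) z ∂μ) / Fintype.card W ≤ 1 := (div_le_one hN).2 hTle
  simp at hstep
  linarith

lemma integrable_of_lintegral_ofReal_le {Z : Type*} [MeasurableSpace Z] {μ : Measure Z}
    {f : Z → ℝ} (hf : AEStronglyMeasurable f μ) (h0 : 0 ≤ᵐ[μ] f) {B : ℝ} (hB : 0 ≤ B)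
    (h : ∫⁻ z, ENNReal.ofReal (f z) ∂μ ≤ ENNReal.ofReal B) :
    Integrable f μ ∧ ∫ z, f z ∂μ ≤ B := by
  refine ⟨⟨hf, ?_⟩, ?_⟩
  · rw [hasFiniteIntegral_iff_ofReal h0]
    exact h.trans_lt ENNReal.ofReal_lt_top
  · rw [integral_eq_lintegral_of_nonneg_ae h0 hf]
    exact ENNReal.toReal_le_of_le_ofReal hB h

variable {L M : ℕ} {ω : Fin M → ℝ} {K : Matrix (Fin L) (Fin L) ℝ}

lemma measurable_label (g : Fin M → ℝ) :
    Measurable fun z : Fin M × EuclideanSpace ℝ (Fin L) => g z.1 :=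
  (Measurable.of_discrete (f := g)).comp measurable_fst

lemma isProbabilityMeasure_blockLaw (k : ℕ) (hω : ∀ s, 0 ≤ ω s) (hω1 : ∑ s, ω s = 1) :
    IsProbabilityMeasure (blockLaw k ω K) := by
  have := isProbabilityMeasure_sourceLaw (K := K) hω hω1
  unfold blockLaw; infer_instance

lemma measurePreserving_blockLaw {k : ℕ} (hω : ∀ s, 0 ≤ ω s) (hω1 : ∑ s, ω s = 1) (j : Fin k) :
    MeasurePreserving (fun z : Fin k → Fin M × EuclideanSpace ℝ (Fin L) => z j)
      (blockLaw k ω K) (sourceLaw ω K) := by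
  have := isProbabilityMeasure_sourceLaw (K := K) hω hω1
  exact measurePreserving_eval (fun _ : Fin k => sourceLaw ω K) j

lemma integrable_label (hω : ∀ s, 0 ≤ ω s) (hω1 : ∑ s, ω s = 1) (g : Fin M → ℝ) :
    Integrable (fun z => g z.1) (sourceLaw ω K) := by
  have := isProbabilityMeasure_sourceLaw (K := K) hω hω1
  have := Measure.isProbabilityMeasure_map (μ := sourceLaw ω K) (f := Prod.fst) (by fun_prop)
  exact (Integrable.of_finite (μ := (sourceLaw ω K).map Prod.fst) (f := g)).comp_measurable
    measurable_fst

lemma integral_label (hω : ∀ s, 0 ≤ ω s) (hω1 : ∑ s, ω s = 1) (g : Fin M → ℝ) :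
    ∫ z, g z.1 ∂(sourceLaw ω K) = ∑ s, ω s * g s := by
  have hint := integrable_label (K := K) hω hω1 g
  unfold sourceLaw at hint ⊢
  rw [integral_finsetSum_measure fun s hs => ?_]
  · refine Finset.sum_congr rfl fun s _ => ?_
    rw [integral_smul_measure, Measure.dirac_prod,
      integral_map (by fun_prop) (measurable_label g).aestronglyMeasurable]
    simp [hω s]
  · exact (integrable_finsetSum_measure.1 hint) s hs

/-- One factor of the likelihood ratio: the density of a proposed posterior law (label `∼ q`,
observations independent `N(a i, d i)`) relative to the source law. It is zero at labels with
`ω s = 0`, which the source produces with probability zero. -/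
noncomputable def symbolRatio (ω : Fin M → ℝ) (K : Matrix (Fin L) (Fin L) ℝ) (q : Fin M → ℝ)
    (a : Fin L → ℝ) (d : Fin L → ℝ≥0) (z : Fin M × EuclideanSpace ℝ (Fin L)) : ℝ :=
  q z.1 / ω z.1 * ∏ i, (gaussianPDFReal (a i) (d i) (z.2 i)
    / gaussianPDFReal ((z.1 : ℕ) + 1) (K i i).toNNReal (z.2 i))

lemma symbolRatio_nonneg (hω : ∀ s, 0 ≤ ω s) {q : Fin M → ℝ} (hq : ∀ s, 0 ≤ q s) (a : Fin L → ℝ)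
    (d : Fin L → ℝ≥0) (z : Fin M × EuclideanSpace ℝ (Fin L)) :
    0 ≤ symbolRatio ω K q a d z :=
  mul_nonneg (div_nonneg (hq _) (hω _)) (Finset.prod_nonneg fun _ _ =>
    div_nonneg (gaussianPDFReal_nonneg _ _ _) (gaussianPDFReal_nonneg _ _ _))

lemma measurable_symbolRatio (q : Fin M → ℝ) (a : Fin L → ℝ) (d : Fin L → ℝ≥0) :
    Measurable (symbolRatio ω K q a d) := by
  refine measurable_from_prod_countable_right fun s => ?_
  unfold symbolRatio
  have hc : ∀ i, Measurable fun x : EuclideanSpace ℝ (Fin L) => x i := fun i => by fun_prop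
  have h : ∀ i, Measurable fun x : EuclideanSpace ℝ (Fin L) =>
      gaussianPDFReal (a i) (d i) (x i)
        / gaussianPDFReal ((s : ℕ) + 1) (K i i).toNNReal (x i) := fun i =>
    ((measurable_gaussianPDFReal _ _).comp (hc i)).div
      ((measurable_gaussianPDFReal _ _).comp (hc i))
  exact (Finset.measurable_fun_prod Finset.univ fun i _ => h i).const_mul (q s / ω s)

lemma lintegral_symbolRatio_le_one (hω : ∀ s, 0 ≤ ω s) (hK : K.PosDef) (hind : CondIndepObs M K)
    {q : Fin M → ℝ} (hq : ∀ s, 0 ≤ q s) (hq1 : ∑ s, q s ≤ 1) (a : Fin L → ℝ) {d : Fin L → ℝ≥0}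
    (hd : ∀ i, d i ≠ 0) :
    ∫⁻ z, ENNReal.ofReal (symbolRatio ω K q a d z) ∂(sourceLaw ω K) ≤ 1 := by
  rw [lintegral_sourceLaw (measurable_symbolRatio q a d).ennreal_ofReal]
  have hKi : ∀ i, (K i i).toNNReal ≠ 0 := fun i => by simpa using hK.diag_pos
  have hin : ∀ s : Fin M, ∫⁻ x, ENNReal.ofReal (symbolRatio ω K q a d (s, x)) ∂(obsLaw K s)
      = ENNReal.ofReal (q s / ω s) := by
    intro s
    have hg : ∀ i : Fin L, Measurable fun y => ENNReal.ofReal (gaussianPDFReal (a i) (d i) y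
        / gaussianPDFReal ((s : ℕ) + 1) (K i i).toNNReal y) := fun i =>
      ((measurable_gaussianPDFReal _ _).div (measurable_gaussianPDFReal _ _)).ennreal_ofReal
    have hsplit : ∀ x : EuclideanSpace ℝ (Fin L), ENNReal.ofReal (symbolRatio ω K q a d (s, x))
        = ENNReal.ofReal (q s / ω s) * ∏ i, ENNReal.ofReal (gaussianPDFReal (a i) (d i) (x i)
          / gaussianPDFReal ((s : ℕ) + 1) (K i i).toNNReal (x i)) := by
      intro x
      rw [symbolRatio, ENNReal.ofReal_mul (div_nonneg (hq _) (hω _)),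
        ENNReal.ofReal_prod_of_nonneg fun i _ =>
          div_nonneg (gaussianPDFReal_nonneg _ _ _) (gaussianPDFReal_nonneg _ _ _)]
    simp only [hsplit]
    rw [lintegral_const_mul' _ _ ENNReal.ofReal_ne_top,
      lintegral_prod_obsLaw hK.posSemidef hind s hg]
    simp [lintegral_gaussianPDFReal_div _ _ (hd _) (hKi _)]
  simp only [hin]
  -- Only an inequality: mass that `q` puts on labels with `ω s = 0` is lost.
  calc ∑ s, ENNReal.ofReal (ω s) * ENNReal.ofReal (q s / ω s)
      ≤ ∑ s, ENNReal.ofReal (q s) := by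
        refine Finset.sum_le_sum fun s _ => ?_
        rw [← ENNReal.ofReal_mul (hω s)]
        refine ENNReal.ofReal_le_ofReal ?_
        rcases (hω s).eq_or_lt with h | h
        · simp [← h, hq s]
        · rw [mul_div_cancel₀ _ h.ne']
    _ ≤ 1 := by
        rw [← ENNReal.ofReal_sum_of_nonneg fun s _ => hq s]
        exact ENNReal.ofReal_le_one.2 hq1

lemma symbolRatio_pos (hK : K.PosDef) {q : Fin M → ℝ} (a : Fin L → ℝ)
    {d : Fin L → ℝ≥0} (hd : ∀ i, d i ≠ 0) {z : Fin M × EuclideanSpace ℝ (Fin L)}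
    (hz : 0 < q z.1) (hωz : 0 < ω z.1) : 0 < symbolRatio ω K q a d z := by
  have hKi : ∀ i, (K i i).toNNReal ≠ 0 := fun i => by simpa using hK.diag_pos
  exact mul_pos (div_pos hz hωz) (Finset.prod_pos fun i _ =>
    div_pos (gaussianPDFReal_pos _ _ _ (hd i)) (gaussianPDFReal_pos _ _ _ (hKi i)))

lemma log_gaussianPDFReal (m : ℝ) {v : ℝ≥0} (hv : v ≠ 0) (x : ℝ) :
    Real.log (gaussianPDFReal m v x)
      = -(Real.log (2 * Real.pi) + Real.log v) / 2 - (x - m) ^ 2 / (2 * v) := by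
  have hv' : (0 : ℝ) < v := by positivity
  rw [gaussianPDFReal, Real.log_mul (by positivity) (Real.exp_pos _).ne', Real.log_exp,
    Real.log_inv, Real.log_sqrt (by positivity), Real.log_mul (by positivity) hv'.ne']
  ring

lemma log_symbolRatio (hK : K.PosDef) {q : Fin M → ℝ} (a : Fin L → ℝ)
    {d : Fin L → ℝ≥0} (hd : ∀ i, d i ≠ 0) {z : Fin M × EuclideanSpace ℝ (Fin L)}
    (hz : 0 < q z.1) (hωz : 0 < ω z.1) :
    Real.log (symbolRatio ω K q a d z) = Real.log (q z.1) - Real.log (ω z.1)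
      + ∑ i, (1 / 2 * Real.log (K i i / d i) - (z.2 i - a i) ^ 2 / (2 * d i)
        + (z.2 i - ((z.1 : ℕ) + 1 : ℝ)) ^ 2 / (2 * K i i)) := by
  have hKpos : ∀ i, 0 < K i i := fun i => hK.diag_pos
  have hKi : ∀ i, (K i i).toNNReal ≠ 0 := fun i => by simpa using hKpos i
  have hp : ∀ i, gaussianPDFReal (a i) (d i) (z.2 i)
      / gaussianPDFReal ((z.1 : ℕ) + 1) (K i i).toNNReal (z.2 i) ≠ 0 := fun i =>
    (div_pos (gaussianPDFReal_pos _ _ _ (hd i)) (gaussianPDFReal_pos _ _ _ (hKi i))).ne'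
  rw [symbolRatio, Real.log_mul (div_pos hz hωz).ne' (Finset.prod_ne_zero_iff.2 fun i _ => hp i),
    Real.log_div hz.ne' hωz.ne', Real.log_prod fun i _ => hp i]
  congr 1
  refine Finset.sum_congr rfl fun i _ => ?_
  have hdi : (d i : ℝ) ≠ 0 := by exact_mod_cast hd i
  rw [Real.log_div (gaussianPDFReal_pos _ _ _ (hd i)).ne' (gaussianPDFReal_pos _ _ _ (hKi i)).ne',
    log_gaussianPDFReal _ (hd i), log_gaussianPDFReal _ (hKi i), Real.log_div (hKpos i).ne' hdi,
    Real.coe_toNNReal _ (hKpos i).le]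
  ring

lemma lintegral_prod_symbolRatio_le_one {k : ℕ} (hω : ∀ s, 0 ≤ ω s) (hω1 : ∑ s, ω s = 1)
    (hK : K.PosDef) (hind : CondIndepObs M K) {q : Fin k → Fin M → ℝ} (hq : ∀ j s, 0 ≤ q j s)
    (hq1 : ∀ j, ∑ s, q j s ≤ 1) (a : Fin k → Fin L → ℝ) {d : Fin L → ℝ≥0} (hd : ∀ i, d i ≠ 0) :
    ∫⁻ z, ENNReal.ofReal (∏ j, symbolRatio ω K (q j) (a j) d (z j)) ∂(blockLaw k ω K) ≤ 1 := by
  have := isProbabilityMeasure_sourceLaw (K := K) hω hω1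
  have hm : ∀ j, Measurable fun z => ENNReal.ofReal (symbolRatio ω K (q j) (a j) d z) := fun j =>
    (measurable_symbolRatio _ _ _).ennreal_ofReal
  have hindep := iIndepFun_pi (μ := fun _ : Fin k => sourceLaw ω K)
    (fun j => (hm j).aemeasurable)
  have h := lintegral_prod_eq_prod_lintegral_of_indepFun Finset.univ _ hindep
    (fun j => (hm j).comp (measurable_pi_apply j))
  simp_rw [ENNReal.ofReal_prod_of_nonneg fun j _ => symbolRatio_nonneg hω (hq j) _ _ _]
  rw [blockLaw, h]
  refine Finset.prod_le_one' fun j _ => ?_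
  exact ((measurePreserving_blockLaw (K := K) hω hω1 j).lintegral_comp (hm j)).trans_le
    (lintegral_symbolRatio_le_one hω hK hind (hq j) (hq1 j) (a j) hd)

end ChangeOfMeasure

/-! ### The converse for a block code -/

section Converse

variable {L M k : ℕ} {ω : Fin M → ℝ} {K : Matrix (Fin L) (Fin L) ℝ}

lemma Code.measurable_message (c : Code L M k) : Measurable c.message := by
  refine measurable_pi_lambda _ fun i => (c.measurable_enc i).comp ?_
  refine measurable_pi_lambda _ fun j => ?_
  fun_prop

lemma Code.measurable_of_message (c : Code L M k) {α : Type*} [MeasurableSpace α]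
    (g : (∀ i, Fin (c.size i)) → α) : Measurable fun z => g (c.message z) :=
  (Measurable.of_discrete (f := g)).comp c.measurable_message

lemma Code.measurable_of_message_label (c : Code L M k) {α : Type*} [MeasurableSpace α]
    (g : (∀ i, Fin (c.size i)) → Fin M → α) (j : Fin k) :
    Measurable fun z : Fin k → Fin M × EuclideanSpace ℝ (Fin L) => g (c.message z) (z j).1 :=
  (Measurable.of_discrete (f := fun p : (∀ i, Fin (c.size i)) × Fin M => g p.1 p.2)).comp
    (c.measurable_message.prodMk (by fun_prop))

lemma Code.size_pos (c : Code L M k) (i : Fin L) : 0 < c.size i :=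
  (c.enc i 0).pos

lemma Code.measurable_sq_error (c : Code L M k) (i : Fin L) (j : Fin k) :
    Measurable fun z : Fin k → Fin M × EuclideanSpace ℝ (Fin L) =>
      ((z j).2 i - c.decX i (c.message z) j) ^ 2 := by
  have h : Measurable fun z : Fin k → Fin M × EuclideanSpace ℝ (Fin L) => (z j).2 i := by fun_prop
  exact (h.sub (c.measurable_of_message fun m => c.decX i m j)).pow_const 2

/-- The distortion constraint on one observation, as a bound on a Bochner integral. -/
lemma Code.integral_sq_error_le (c : Code L M k) (hk : 1 ≤ k) (i : Fin L) {d : ℝ≥0}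
    (h : c.obsDist ω K i ≤ d) :
    Integrable (fun z => ∑ j, ((z j).2 i - c.decX i (c.message z) j) ^ 2) (blockLaw k ω K) ∧
      ∫ z, ∑ j, ((z j).2 i - c.decX i (c.message z) j) ^ 2 ∂(blockLaw k ω K) ≤ k * d := by
  have hk0 : (k : ℝ≥0∞) ≠ 0 := by simp; omega
  refine integrable_of_lintegral_ofReal_le
    (Finset.measurable_sum _ fun j _ => c.measurable_sq_error i j).aestronglyMeasurable
    (.of_forall fun z => Finset.sum_nonneg fun j _ => sq_nonneg _) (by positivity) ?_
  simp_rw [ENNReal.ofReal_sum_of_nonneg fun j _ => sq_nonneg _]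
  rw [obsDist, lintegral_const_mul' _ _ (ENNReal.inv_ne_top.2 hk0)] at h
  have h' := mul_le_mul_right h (k : ℝ≥0∞)
  rw [← mul_assoc, ENNReal.mul_inv_cancel hk0 (by simp), one_mul] at h'
  refine h'.trans_eq ?_
  rw [ENNReal.ofReal_mul (by positivity)]
  simp

lemma integral_blockLaw_sum (hω : ∀ s, 0 ≤ ω s) (hω1 : ∑ s, ω s = 1)
    {g : Fin M × EuclideanSpace ℝ (Fin L) → ℝ} (hg : Integrable g (sourceLaw ω K)) :
    Integrable (fun z => ∑ j, g (z j)) (blockLaw k ω K) ∧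
      ∫ z, ∑ j, g (z j) ∂(blockLaw k ω K) = k * ∫ z, g z ∂(sourceLaw ω K) := by
  have hmp := fun j : Fin k => measurePreserving_blockLaw (K := K) hω hω1 j
  have hi : ∀ j : Fin k, Integrable (fun z => g (z j)) (blockLaw k ω K) := fun j =>
    (hmp j).integrable_comp_of_integrable hg
  refine ⟨integrable_finsetSum _ fun j _ => hi j, ?_⟩
  rw [integral_finsetSum _ fun j _ => hi j]
  have : ∀ j : Fin k, ∫ z, g (z j) ∂(blockLaw k ω K) = ∫ z, g z ∂(sourceLaw ω K) := by
    intro j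
    rw [← (hmp j).map_eq, integral_map (hmp j).measurable.aemeasurable]
    rw [(hmp j).map_eq]
    exact hg.aestronglyMeasurable
  simp [this]

lemma integral_sq_sub_label (hω : ∀ s, 0 ≤ ω s) (hω1 : ∑ s, ω s = 1) (hK : K.PosSemidef)
    (i : Fin L) :
    Integrable (fun z => (z.2 i - ((z.1 : ℕ) + 1 : ℝ)) ^ 2) (sourceLaw ω K) ∧
      ∫ z, (z.2 i - ((z.1 : ℕ) + 1 : ℝ)) ^ 2 ∂(sourceLaw ω K) = K i i := by
  have h := lintegral_sq_sub_label hω hω1 hK i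
  have hm : Measurable fun z : Fin M × EuclideanSpace ℝ (Fin L) =>
      (z.2 i - ((z.1 : ℕ) + 1 : ℝ)) ^ 2 :=
    Measurable.pow_const (Measurable.sub (by fun_prop)
      (measurable_label fun s => ((s : ℕ) + 1 : ℝ))) 2
  refine ⟨(integrable_of_lintegral_ofReal_le hm.aestronglyMeasurable
    (.of_forall fun z => sq_nonneg _) hK.diag_nonneg h.le).1, ?_⟩
  rw [integral_eq_lintegral_of_nonneg_ae (.of_forall fun z => sq_nonneg _)
    hm.aestronglyMeasurable, h, ENNReal.toReal_ofReal hK.diag_nonneg]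

/-- The converse in natural logarithms. Here `q m j` is any probability assignment to the `j`-th
label given the messages; its expected log loss replaces the conditional entropy of the labels.
The Gaussian quadratic terms cancel up to the gap in the distortion constraint. -/
theorem Code.log_card_message_ge (c : Code L M k) (hk : 1 ≤ k) (hω : ∀ s, 0 ≤ ω s)
    (hω1 : ∑ s, ω s = 1) (hK : K.PosDef) (hind : CondIndepObs M K)
    {d : Fin L → ℝ≥0} (hd : ∀ i, d i ≠ 0) (hdist : ∀ i, c.obsDist ω K i ≤ d i)
    (q : (∀ i, Fin (c.size i)) → Fin k → Fin M → ℝ) (hq : ∀ m j s, 0 ≤ q m j s)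
    (hq1 : ∀ m j, ∑ s, q m j s ≤ 1)
    (hqpos : ∀ᵐ z ∂(blockLaw k ω K), ∀ j, 0 < q (c.message z) j (z j).1)
    (hqint : Integrable (fun z => ∑ j, Real.log (q (c.message z) j (z j).1)) (blockLaw k ω K)) :
    k * (-∑ s, ω s * Real.log (ω s)) + k * ∑ i, 1 / 2 * Real.log (K i i / d i)
        + ∫ z, ∑ j, Real.log (q (c.message z) j (z j).1) ∂(blockLaw k ω K)
      ≤ ∑ i, Real.log (c.size i) := by
  have := isProbabilityMeasure_blockLaw (K := K) k hω hω1
  have : Nonempty (∀ i, Fin (c.size i)) := ⟨fun i => ⟨0, c.size_pos i⟩⟩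
  let T : (∀ i, Fin (c.size i)) → (Fin k → Fin M × EuclideanSpace ℝ (Fin L)) → ℝ := fun m z =>
    ∏ j, symbolRatio ω K (q m j) (fun i => c.decX i m j) d (z j)
  have hωpos : ∀ᵐ z ∂(blockLaw k ω K), ∀ j, 0 < ω (z j).1 := by
    rw [ae_all_iff]
    exact fun j => (measurePreserving_blockLaw (K := K) hω hω1 j).quasiMeasurePreserving.ae
      ae_label_pos
  have hTpos : ∀ᵐ z ∂(blockLaw k ω K), 0 < T (c.message z) z := by
    filter_upwards [hqpos, hωpos] with z h1 h2
    exact Finset.prod_pos fun j _ => symbolRatio_pos hK _ hd (h1 j) (h2 j)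
  have hE := fun i => c.integral_sq_error_le hk i (hdist i)
  have hFone := fun i => integral_sq_sub_label hω hω1 hK.posSemidef i
  have hF := fun i => integral_blockLaw_sum (k := k) hω hω1 (hFone i).1
  have hB := integral_blockLaw_sum (k := k) hω hω1
    (integrable_label (K := K) hω hω1 fun s => Real.log (ω s))
  let G : (Fin k → Fin M × EuclideanSpace ℝ (Fin L)) → ℝ := fun z =>
    ∑ j, Real.log (q (c.message z) j (z j).1) - ∑ j, Real.log (ω (z j).1)
      + ∑ i, (k * (1 / 2 * Real.log (K i i / d i))
        - (∑ j, ((z j).2 i - c.decX i (c.message z) j) ^ 2) / (2 * d i)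
        + (∑ j, ((z j).2 i - (((z j).1 : ℕ) + 1 : ℝ)) ^ 2) / (2 * K i i))
  have hlog : (fun z => Real.log (T (c.message z) z)) =ᵐ[blockLaw k ω K] G := by
    filter_upwards [hqpos, hωpos] with z h1 h2
    simp only [T, G]
    rw [Real.log_prod fun j _ => (symbolRatio_pos hK _ hd (h1 j) (h2 j)).ne']
    rw [Finset.sum_congr rfl fun j _ => log_symbolRatio hK _ hd (h1 j) (h2 j)]
    rw [Finset.sum_add_distrib, Finset.sum_sub_distrib, Finset.sum_comm]
    congr 1
    refine Finset.sum_congr rfl fun i _ => ?_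
    rw [Finset.sum_add_distrib, Finset.sum_sub_distrib, Finset.sum_div, Finset.sum_div]
    simp
  have hi : ∀ i, Integrable (fun z : Fin k → Fin M × EuclideanSpace ℝ (Fin L) =>
      k * (1 / 2 * Real.log (K i i / d i))
        - (∑ j, ((z j).2 i - c.decX i (c.message z) j) ^ 2) / (2 * d i)
        + (∑ j, ((z j).2 i - (((z j).1 : ℕ) + 1 : ℝ)) ^ 2) / (2 * K i i)) (blockLaw k ω K) :=
    fun i => ((integrable_const _).sub ((hE i).1.div_const _)).add ((hF i).1.div_const _)
  have hGint : Integrable G (blockLaw k ω K) :=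
    (hqint.sub hB.1).add (integrable_finsetSum _ fun i _ => hi i)
  have hmain := integral_log_selected_le (blockLaw k ω K) c.message T
    (fun m z => Finset.prod_nonneg fun j _ => symbolRatio_nonneg hω (hq m j) _ _ _)
    (fun m => Finset.measurable_prod _ fun j _ =>
      (measurable_symbolRatio _ _ _).comp (measurable_pi_apply j))
    (fun m => lintegral_prod_symbolRatio_le_one hω hω1 hK hind (hq m) (hq1 m) _ hd)
    hTpos (hGint.congr hlog.symm)
  have hGval : ∫ z, G z ∂(blockLaw k ω K)
      = ∫ z, ∑ j, Real.log (q (c.message z) j (z j).1) ∂(blockLaw k ω K)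
        - k * ∑ s, ω s * Real.log (ω s)
        + ∑ i, (k * (1 / 2 * Real.log (K i i / d i))
          - (∫ z, ∑ j, ((z j).2 i - c.decX i (c.message z) j) ^ 2 ∂(blockLaw k ω K)) / (2 * d i)
          + k * K i i / (2 * K i i)) := by
    have hqB : Integrable (fun z => ∑ j, Real.log (q (c.message z) j (z j).1)
        - ∑ j, Real.log (ω (z j).1)) (blockLaw k ω K) := hqint.sub hB.1
    simp only [G]
    rw [integral_add hqB (integrable_finsetSum _ fun i _ => hi i),
      integral_sub hqint hB.1, hB.2, 
      integral_label hω hω1 fun s => Real.log (ω s),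
      integral_finsetSum _ fun i _ => hi i]
    congr 1
    refine Finset.sum_congr rfl fun i _ => ?_
    have hcE : Integrable (fun z => k * (1 / 2 * Real.log (K i i / d i))
        - (∑ j, ((z j).2 i - c.decX i (c.message z) j) ^ 2) / (2 * d i)) (blockLaw k ω K) :=
      (integrable_const _).sub ((hE i).1.div_const _)
    rw [integral_add hcE ((hF i).1.div_const _),
      integral_sub (integrable_const _) ((hE i).1.div_const _), integral_div, integral_div,
      (hF i).2, (hFone i).2]
    simp
  have hterm : ∀ i, k * (1 / 2 * Real.log (K i i / d i))
      ≤ k * (1 / 2 * Real.log (K i i / d i))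
        - (∫ z, ∑ j, ((z j).2 i - c.decX i (c.message z) j) ^ 2 ∂(blockLaw k ω K)) / (2 * d i)
        + k * K i i / (2 * K i i) := by
    intro i
    have hdi : (0 : ℝ) < d i := by have := hd i; positivity
    have hKi : 0 < K i i := hK.diag_pos
    -- Both sides are `k / 2`: the source term balances the largest admissible distortion term.
    have h1 : k * K i i / (2 * K i i) = k * d i / (2 * d i) := by field_simp
    have h2 := div_le_div_of_nonneg_right (hE i).2 (by positivity : (0 : ℝ) ≤ 2 * d i)
    linarith
  have hsum := Finset.sum_le_sum fun i (_ : i ∈ Finset.univ) => hterm i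
  rw [integral_congr_ae hlog, hGval] at hmain
  have hcard : Real.log (Fintype.card (∀ i, Fin (c.size i))) = ∑ i, Real.log (c.size i) := by
    rw [Fintype.card_pi, Nat.cast_prod, Real.log_prod fun i _ => ?_]
    · simp
    · simpa using (c.size_pos i).ne'
  rw [hcard] at hmain
  rw [← Finset.mul_sum] at hsum
  linarith

end Converse

/-! ### The two bounds on the label term -/

section LabelTerm

variable {L M k : ℕ} {ω : Fin M → ℝ} {K : Matrix (Fin L) (Fin L) ℝ}

/-- The converse in bits, for an arbitrary probability assignment `q` to the labels whose log
loss is at most `B` bits per symbol. -/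
theorem Code.sumRate_ge (c : Code L M k) (hk : 1 ≤ k) (hω : ∀ s, 0 ≤ ω s)
    (hω1 : ∑ s, ω s = 1) (hK : K.PosDef) (hind : CondIndepObs M K)
    {d : Fin L → ℝ≥0} (hd : ∀ i, d i ≠ 0) (hdist : ∀ i, c.obsDist ω K i ≤ d i)
    (q : (∀ i, Fin (c.size i)) → Fin k → Fin M → ℝ) (hq : ∀ m j s, 0 ≤ q m j s)
    (hq1 : ∀ m j, ∑ s, q m j s ≤ 1)
    (hqpos : ∀ᵐ z ∂(blockLaw k ω K), ∀ j, 0 < q (c.message z) j (z j).1)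
    (hqint : Integrable (fun z => ∑ j, Real.log (q (c.message z) j (z j).1)) (blockLaw k ω K))
    {B : ℝ} (hB : -(k * B * Real.log 2)
      ≤ ∫ z, ∑ j, Real.log (q (c.message z) j (z j).1) ∂(blockLaw k ω K)) :
    entropy ω - B + ∑ i, 1 / 2 * Real.logb 2 (K i i / d i) ≤ c.sumRate := by
  have h := c.log_card_message_ge hk hω hω1 hK hind hd hdist q hq hq1 hqpos hqint
  have h2 : 0 < Real.log 2 := Real.log_pos one_lt_two
  have hk0 : (0 : ℝ) < k := by exact_mod_cast hk
  have e1 : entropy ω * Real.log 2 = -∑ s, ω s * Real.log (ω s) := by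
    rw [entropy, neg_mul, Finset.sum_mul]
    congr 1
    refine Finset.sum_congr rfl fun s _ => ?_
    rw [Real.logb]; field_simp
  have e2 : (∑ i, 1 / 2 * Real.logb 2 (K i i / d i)) * Real.log 2
      = ∑ i, 1 / 2 * Real.log (K i i / d i) := by
    rw [Finset.sum_mul]
    refine Finset.sum_congr rfl fun i _ => ?_
    rw [Real.logb]; field_simp
  have e3 : k * (c.sumRate * Real.log 2) = ∑ i, Real.log (c.size i) := by
    rw [Code.sumRate, Finset.sum_mul, Finset.mul_sum]
    refine Finset.sum_congr rfl fun i _ => ?_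
    rw [Real.logb]; field_simp
  rw [← e1, ← e2, ← e3] at h
  have : (k * Real.log 2) * (entropy ω - B + ∑ i, 1 / 2 * Real.logb 2 (K i i / d i))
      ≤ (k * Real.log 2) * c.sumRate := by linarith
  exact le_of_mul_le_mul_left this (by positivity)

lemma Code.softLabel_sum (c : Code L M k) (m : ∀ i, Fin (c.size i)) (j : Fin k) :
    ∑ s, (c.softLabel m j s).toReal = 1 := by
  rw [← ENNReal.toReal_sum fun s _ => PMF.apply_ne_top _ _, ← tsum_fintype (L := .unconditional _),
    PMF.tsum_coe, ENNReal.toReal_one]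

/-- The decoder's own soft labels used as the probability assignment. -/
theorem Code.sumRate_ge_of_semDist (c : Code L M k) (hk : 1 ≤ k) (hω : ∀ s, 0 ≤ ω s)
    (hω1 : ∑ s, ω s = 1) (hK : K.PosDef) (hind : CondIndepObs M K)
    {d : Fin L → ℝ≥0} (hd : ∀ i, d i ≠ 0) (hdist : ∀ i, c.obsDist ω K i ≤ d i)
    {DS : ℝ≥0} (hS : c.semDist ω K ≤ DS) :
    entropy ω - DS + ∑ i, 1 / 2 * Real.logb 2 (K i i / d i) ≤ c.sumRate := by
  have hk0 : (k : ℝ≥0∞) ≠ 0 := by simp; omega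
  have hloss : ∫⁻ z, ∑ j, logLoss (z j).1 (c.softLabel (c.message z) j) ∂(blockLaw k ω K)
      ≤ ENNReal.ofReal (k * DS) := by
    rw [semDist, lintegral_const_mul' _ _ (ENNReal.inv_ne_top.2 hk0)] at hS
    have h' := mul_le_mul_right hS (k : ℝ≥0∞)
    rw [← mul_assoc, ENNReal.mul_inv_cancel hk0 (by simp), one_mul] at h'
    refine h'.trans_eq ?_
    rw [ENNReal.ofReal_mul (by positivity)]
    simp
  have hle1 : ∀ m j s, (c.softLabel m j s).toReal ≤ 1 := fun m j s =>
    ENNReal.toReal_le_of_le_ofReal zero_le_one (by simpa using PMF.coe_le_one _ _)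
  have hnonneg : ∀ m j s, 0 ≤ -Real.logb 2 (c.softLabel m j s).toReal := fun m j s =>
    neg_nonneg.2 (Real.logb_nonpos one_lt_two ENNReal.toReal_nonneg (hle1 m j s))
  have hbits := integrable_of_lintegral_ofReal_le (μ := blockLaw k ω K)
    (f := fun z => ∑ j, -Real.logb 2 (c.softLabel (c.message z) j (z j).1).toReal)
    (Finset.measurable_fun_sum _ fun j _ => c.measurable_of_message_label
      (fun m s => -Real.logb 2 (c.softLabel m j s).toReal) j).aestronglyMeasurable
    (.of_forall fun z => Finset.sum_nonneg fun j _ => hnonneg _ _ _)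
    (B := k * DS) (by positivity) (by
      refine le_trans (lintegral_mono fun z => ?_) hloss
      rw [ENNReal.ofReal_sum_of_nonneg fun j _ => hnonneg _ _ _]
      refine Finset.sum_le_sum fun j _ => ?_
      unfold logLoss
      split_ifs
      · exact le_top
      · exact le_rfl)
  -- `Real.log 0 = Real.logb 2 0 = 0`, so this identity needs no positivity.
  have hln : (fun z => ∑ j, Real.log (c.softLabel (c.message z) j (z j).1).toReal)
      = fun z => -Real.log 2
        * ∑ j, -Real.logb 2 (c.softLabel (c.message z) j (z j).1).toReal := by
    funext z
    rw [Finset.mul_sum]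
    refine Finset.sum_congr rfl fun j _ => ?_
    have h2 : 0 < Real.log 2 := Real.log_pos one_lt_two
    rw [Real.logb]; field_simp
  refine c.sumRate_ge hk hω hω1 hK hind hd hdist (fun m j s => (c.softLabel m j s).toReal)
    (fun _ _ _ => ENNReal.toReal_nonneg) (fun m j => (c.softLabel_sum m j).le) ?_ ?_ ?_
  · have hfin := ae_lt_top (μ := blockLaw k ω K)
      (f := fun z => ∑ j, logLoss (z j).1 (c.softLabel (c.message z) j))
      (Finset.measurable_fun_sum _ fun j _ => c.measurable_of_message_label
        (fun m s => logLoss s (c.softLabel m j)) j) (hloss.trans_lt ENNReal.ofReal_lt_top).ne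
    filter_upwards [hfin] with z hz j
    have hj := (ENNReal.sum_lt_top.1 hz) j (Finset.mem_univ j)
    refine ENNReal.toReal_pos (fun h0 => ?_) (PMF.apply_ne_top _ _)
    simp [logLoss, h0] at hj
  · rw [hln]
    exact hbits.1.const_mul _
  · rw [hln, integral_const_mul]
    have h2 : 0 < Real.log 2 := Real.log_pos one_lt_two
    nlinarith [mul_le_mul_of_nonneg_left hbits.2 h2.le]

/-- Fano's inequality, in the form obtained from the assignment that gives mass `1/2` to an
estimate of the label and shares the rest equally among the other labels. -/
theorem Code.sumRate_ge_of_error (c : Code L M k) (hM : 2 ≤ M) (hk : 1 ≤ k) (hω : ∀ s, 0 ≤ ω s)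
    (hω1 : ∑ s, ω s = 1) (hK : K.PosDef) (hind : CondIndepObs M K)
    {d : Fin L → ℝ≥0} (hd : ∀ i, d i ≠ 0) (hdist : ∀ i, c.obsDist ω K i ≤ d i)
    (est : (∀ i, Fin (c.size i)) → Fin k → Fin M) {p : ℝ}
    (hp : ∑ j, (blockLaw k ω K).real {z | (z j).1 ≠ est (c.message z) j} ≤ k * p) :
    entropy ω - (1 + Real.logb 2 ((M : ℝ) - 1) * p) + ∑ i, 1 / 2 * Real.logb 2 (K i i / d i)
      ≤ c.sumRate := by
  have := isProbabilityMeasure_blockLaw (K := K) k hω hω1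
  have hM1 : (1 : ℝ) ≤ (M : ℝ) - 1 := by
    have : (2 : ℝ) ≤ M := by exact_mod_cast hM
    linarith
  have hM0 : (0 : ℝ) < (M : ℝ) - 1 := by linarith
  have hlogM : 0 ≤ Real.log ((M : ℝ) - 1) := Real.log_nonneg hM1
  have h2 : 0 < Real.log 2 := Real.log_pos one_lt_two
  let q : (∀ i, Fin (c.size i)) → Fin k → Fin M → ℝ := fun m j s =>
    if s = est m j then 1 / 2 else 1 / (2 * ((M : ℝ) - 1))
  have hqpos : ∀ m j s, 0 < q m j s := by
    intro m j s
    simp only [q]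
    split_ifs <;> positivity
  have hq1 : ∀ m j, ∑ s, q m j s = 1 := by
    intro m j
    simp only [q]
    rw [Finset.sum_ite, Finset.sum_const, Finset.sum_const, Finset.filter_eq' _ (est m j),
      Finset.filter_ne' _ (est m j)]
    simp only [Finset.mem_univ, if_true, Finset.card_singleton, Finset.card_erase_of_mem,
      Finset.card_univ, Fintype.card_fin, nsmul_eq_mul]
    rw [Nat.cast_sub (by omega)]
    push_cast
    field_simp
    norm_num
  have hS : ∀ j, MeasurableSet {z : Fin k → Fin M × EuclideanSpace ℝ (Fin L) |
      (z j).1 ≠ est (c.message z) j} := fun j =>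
    (c.measurable_of_message_label (fun m s => s ≠ est m j) j).setOf
  have hlog : (fun z => ∑ j, Real.log (q (c.message z) j (z j).1))
      = fun z => ∑ j, (-Real.log 2 - Real.log ((M : ℝ) - 1)
        * Set.indicator {z : Fin k → Fin M × EuclideanSpace ℝ (Fin L) |
            (z j).1 ≠ est (c.message z) j} 1 z) := by
    funext z
    refine Finset.sum_congr rfl fun j _ => ?_
    by_cases h : (z j).1 = est (c.message z) j
    · simp [q, h, Set.indicator]
    · simp only [q, h, if_false, Set.indicator, ne_eq, Set.mem_ofPred_eq, not_false_eq_true,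
        if_true, Pi.one_apply, mul_one]
      rw [Real.log_div one_ne_zero (by positivity), Real.log_mul two_ne_zero hM0.ne']
      simp
      ring
  have hindic : ∀ j, Integrable (fun z => Real.log ((M : ℝ) - 1)
        * Set.indicator {z : Fin k → Fin M × EuclideanSpace ℝ (Fin L) |
            (z j).1 ≠ est (c.message z) j} 1 z) (blockLaw k ω K) := fun j =>
    ((integrable_const (1 : ℝ)).indicator (hS j)).const_mul _
  have hint : ∀ j, Integrable (fun z => -Real.log 2 - Real.log ((M : ℝ) - 1)
        * Set.indicator {z : Fin k → Fin M × EuclideanSpace ℝ (Fin L) |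
            (z j).1 ≠ est (c.message z) j} 1 z) (blockLaw k ω K) := fun j =>
    (integrable_const _).sub (hindic j)
  refine c.sumRate_ge hk hω hω1 hK hind hd hdist q (fun m j s => (hqpos m j s).le)
    (fun m j => (hq1 m j).le) (.of_forall fun z j => hqpos _ _ _) ?_ ?_
  · rw [hlog]
    exact integrable_finsetSum _ fun j _ => hint j
  · rw [hlog, integral_finsetSum _ fun j _ => hint j]
    have hval : ∀ j, ∫ z, (-Real.log 2 - Real.log ((M : ℝ) - 1)
        * Set.indicator {z : Fin k → Fin M × EuclideanSpace ℝ (Fin L) |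
            (z j).1 ≠ est (c.message z) j} 1 z) ∂(blockLaw k ω K)
        = -Real.log 2 - Real.log ((M : ℝ) - 1)
          * (blockLaw k ω K).real {z | (z j).1 ≠ est (c.message z) j} := by
      intro j
      rw [integral_sub (integrable_const _) (hindic j), integral_const_mul,
        integral_indicator_one (hS j)]
      simp
    rw [Finset.sum_congr rfl fun j _ => hval j, Finset.sum_sub_distrib, ← Finset.mul_sum]
    have hmul := mul_le_mul_of_nonneg_left hp hlogM
    have hbits : Real.logb 2 ((M : ℝ) - 1) * Real.log 2 = Real.log ((M : ℝ) - 1) := by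
      rw [Real.logb]; field_simp
    simp only [Finset.sum_const, Finset.card_univ, Fintype.card_fin, nsmul_eq_mul]
    have hexp : k * (1 + Real.logb 2 ((M : ℝ) - 1) * p) * Real.log 2
        = k * Real.log 2 + (Real.logb 2 ((M : ℝ) - 1) * Real.log 2) * (k * p) := by ring
    rw [hexp, hbits]
    linarith

end LabelTerm

/-! ### Label errors from the observation reconstructions -/

section LabelError

variable {L M k : ℕ} {ω : Fin M → ℝ} {K : Matrix (Fin L) (Fin L) ℝ}

/-- A nearest-label rule: distinct labels are at distance at least one, so at most one label lies
within distance `1/2` of a given real number. -/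
lemma exists_nearest_label (hM : 0 < M) :
    ∃ f : ℝ → Fin M, ∀ (y : ℝ) (s : Fin M), |y - ((s : ℕ) + 1 : ℝ)| < 1 / 2 → f y = s := by
  classical
  refine ⟨fun y => if h : ∃ s : Fin M, |y - ((s : ℕ) + 1 : ℝ)| < 1 / 2 then h.choose else ⟨0, hM⟩,
    fun y s hs => ?_⟩
  have h : ∃ s : Fin M, |y - ((s : ℕ) + 1 : ℝ)| < 1 / 2 := ⟨s, hs⟩
  have hc := h.choose_spec
  simp only [h, dif_pos]
  rw [abs_lt] at hs hc
  have h1 : ((h.choose : ℕ) : ℝ) < (s : ℕ) + 1 := by linarith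
  have h2 : ((s : ℕ) : ℝ) < (h.choose : ℕ) + 1 := by linarith
  have h1' : (h.choose : ℕ) < (s : ℕ) + 1 := by exact_mod_cast h1
  have h2' : (s : ℕ) < (h.choose : ℕ) + 1 := by exact_mod_cast h2
  exact Fin.ext (by omega)

/-- If the mean of `x` is within `α` of the label `t` and the mean squared gap between `x` and `y`
is below `(1/2 - α)²`, then the mean of `y` is within `1/2` of the label. -/
lemma abs_mean_sub_lt (hL : 1 ≤ L) {x y : Fin L → ℝ} {t α : ℝ} (hα : α < 1 / 2)
    (h1 : |(∑ i, x i) / L - t| ≤ α) (h2 : (∑ i, (x i - y i) ^ 2) / L < (1 / 2 - α) ^ 2) :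
    |(∑ i, y i) / L - t| < 1 / 2 := by
  have hL0 : (0 : ℝ) < L := by exact_mod_cast hL
  have hcs : ((∑ i, x i) / L - (∑ i, y i) / L) ^ 2 ≤ (∑ i, (x i - y i) ^ 2) / L := by
    have h := sq_sum_le_card_mul_sum_sq (s := Finset.univ) (f := fun i => x i - y i)
    rw [Finset.card_univ, Fintype.card_fin] at h
    rw [← sub_div, ← Finset.sum_sub_distrib, div_pow, div_le_div_iff₀ (by positivity) hL0]
    nlinarith [mul_le_mul_of_nonneg_right h hL0.le]
  have h3 := abs_lt_of_sq_lt_sq (hcs.trans_lt h2) (by linarith)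
  rw [abs_lt] at h3 ⊢
  rw [abs_le] at h1
  constructor <;> linarith

/-- The total label error probability of the nearest-label estimate: either the true mean of the
observations strays from the label (Gaussian tail) or the reconstruction error is large (Markov). -/
lemma Code.sum_error_le (c : Code L M k) (hL : 1 ≤ L) (hk : 1 ≤ k) (hω : ∀ s, 0 ≤ ω s)
    (hω1 : ∑ s, ω s = 1) (hK : K.PosDef) (hind : CondIndepObs M K)
    {d : Fin L → ℝ≥0} (hdist : ∀ i, c.obsDist ω K i ≤ d i) {f : ℝ → Fin M}
    (hf : ∀ (y : ℝ) (s : Fin M), |y - ((s : ℕ) + 1 : ℝ)| < 1 / 2 → f y = s)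
    {α : ℝ} (hα : α < 1 / 2) :
    ∑ j, (blockLaw k ω K).real
        {z | (z j).1 ≠ f ((∑ i, c.decX i (c.message z) j) / L)}
      ≤ k * (2 * Qfun (L * α / √K.trace)
        + 1 / (L : ℝ) * ((1 / 2 - α) ^ 2)⁻¹ * ∑ i, (d i : ℝ)) := by
  have := isProbabilityMeasure_blockLaw (K := K) k hω hω1
  have hL0 : (0 : ℝ) < L := by exact_mod_cast hL
  have hε : 0 < (1 / 2 - α) ^ 2 := by
    have : 0 < 1 / 2 - α := by linarith
    positivity
  have hE := fun i => c.integral_sq_error_le hk i (hdist i)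
  have hEj : ∀ i j, Integrable (fun z => ((z j).2 i - c.decX i (c.message z) j) ^ 2)
      (blockLaw k ω K) := fun i j =>
    (hE i).1.mono' (c.measurable_sq_error i j).aestronglyMeasurable (.of_forall fun z => by
      rw [Real.norm_of_nonneg (sq_nonneg _)]
      exact Finset.single_le_sum
        (f := fun j => ((z j).2 i - c.decX i (c.message z) j) ^ 2)
        (fun _ _ => sq_nonneg _) (Finset.mem_univ j))
  have hGj : ∀ j, Integrable
      (fun z => (∑ i, ((z j).2 i - c.decX i (c.message z) j) ^ 2) / L) (blockLaw k ω K) :=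
    fun j => (integrable_finsetSum _ fun i _ => hEj i j).div_const _
  have hj : ∀ j, (blockLaw k ω K).real {z | (z j).1 ≠ f ((∑ i, c.decX i (c.message z) j) / L)}
      ≤ 2 * Qfun (L * α / √K.trace) + ((1 / 2 - α) ^ 2)⁻¹
        * ∫ z, (∑ i, ((z j).2 i - c.decX i (c.message z) j) ^ 2) / L ∂(blockLaw k ω K) := by
    intro j
    have hsub : {z : Fin k → Fin M × EuclideanSpace ℝ (Fin L) |
          (z j).1 ≠ f ((∑ i, c.decX i (c.message z) j) / L)}
        ⊆ {z | α < |(∑ i, (z j).2 i) / L - (((z j).1 : ℕ) + 1 : ℝ)|}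
          ∪ {z | (1 / 2 - α) ^ 2
              ≤ (∑ i, ((z j).2 i - c.decX i (c.message z) j) ^ 2) / L} := by
      intro z hz
      by_contra hcon
      simp only [Set.mem_union, Set.mem_ofPred_eq, not_or, not_lt, not_le] at hcon
      exact hz (hf _ _ (abs_mean_sub_lt hL hα hcon.1 hcon.2)).symm
    have htail : (blockLaw k ω K).real
        {z | α < |(∑ i, (z j).2 i) / L - (((z j).1 : ℕ) + 1 : ℝ)|}
        ≤ 2 * Qfun (L * α / √K.trace) := by
      have hmeas : MeasurableSet {z : Fin M × EuclideanSpace ℝ (Fin L) |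
          α < |(∑ i, z.2 i) / L - ((z.1 : ℕ) + 1 : ℝ)|} :=
        measurableSet_lt measurable_const (continuous_abs.measurable.comp
          (Measurable.sub (by fun_prop) (measurable_label fun s => ((s : ℕ) + 1 : ℝ))))
      refine ENNReal.toReal_le_of_le_ofReal
        (mul_nonneg zero_le_two measureReal_nonneg) ?_
      refine le_trans (le_of_eq ?_) (sourceLaw_mean_tail hL hω hω1 hK hind α)
      exact (measurePreserving_blockLaw (K := K) hω hω1 j).measure_preimage
        hmeas.nullMeasurableSet
    have hmarkov := mul_meas_ge_le_integral_of_nonneg (μ := blockLaw k ω K)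
      (.of_forall fun z => by positivity) (hGj j) ((1 / 2 - α) ^ 2)
    rw [← le_inv_mul_iff₀ hε] at hmarkov
    exact (measureReal_mono hsub).trans ((measureReal_union_le _ _).trans
      (add_le_add htail hmarkov))
  have htotal : ∑ j, ∫ z, (∑ i, ((z j).2 i - c.decX i (c.message z) j) ^ 2) / L
      ∂(blockLaw k ω K) ≤ k * (1 / (L : ℝ) * ∑ i, (d i : ℝ)) := by
    have hswap : ∑ j, ∫ z, (∑ i, ((z j).2 i - c.decX i (c.message z) j) ^ 2) / L
        ∂(blockLaw k ω K) = (∑ i, ∫ z, ∑ j, ((z j).2 i - c.decX i (c.message z) j) ^ 2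
          ∂(blockLaw k ω K)) / L := by
      simp_rw [integral_div]
      rw [← Finset.sum_div]
      congr 1
      rw [Finset.sum_congr rfl fun j _ => integral_finsetSum _ fun i _ => hEj i j,
        Finset.sum_comm]
      exact Finset.sum_congr rfl fun i _ => (integral_finsetSum _ fun j _ => hEj i j).symm
    rw [hswap]
    calc _ ≤ (∑ i, k * (d i : ℝ)) / L :=
          div_le_div_of_nonneg_right (Finset.sum_le_sum fun i _ => (hE i).2) hL0.le
      _ = _ := by rw [← Finset.mul_sum]; ring
  calc _ ≤ ∑ j : Fin k, (2 * Qfun (L * α / √K.trace) + ((1 / 2 - α) ^ 2)⁻¹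
        * ∫ z, (∑ i, ((z j).2 i - c.decX i (c.message z) j) ^ 2) / L ∂(blockLaw k ω K)) :=
        Finset.sum_le_sum fun j _ => hj j
    _ ≤ k * (2 * Qfun (L * α / √K.trace))
        + ((1 / 2 - α) ^ 2)⁻¹ * (k * (1 / (L : ℝ) * ∑ i, (d i : ℝ))) := by
      rw [Finset.sum_add_distrib]
      refine add_le_add (by simp) ?_
      rw [← Finset.mul_sum]
      exact mul_le_mul_of_nonneg_left htotal (inv_nonneg.2 hε.le)
    _ = _ := by ring

end LabelError

/-! ### The outer bound at the diagonal matrix of distortions -/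

section OuterBound

variable {L M k : ℕ} {ω : Fin M → ℝ} {K : Matrix (Fin L) (Fin L) ℝ}

/-- The matrix `diag(D₁, …, D_L)`, which turns out to be optimal. -/
noncomputable def distMatrix (DX : Fin L → ℝ≥0) : Matrix (Fin L) (Fin L) ℝ :=
  Matrix.diagonal fun i => (DX i : ℝ)

lemma det_distMatrix (DX : Fin L → ℝ≥0) : (distMatrix DX).det = ∏ i, (DX i : ℝ) :=
  Matrix.det_diagonal

lemma trace_distMatrix (DX : Fin L → ℝ≥0) : (distMatrix DX).trace = ∑ i, (DX i : ℝ) :=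
  Matrix.trace_diagonal _

lemma det_le_one_of_trace_le {ι : Type*} [Fintype ι] [DecidableEq ι] {A : Matrix ι ι ℝ}
    (hA : A.PosSemidef) (htr : A.trace ≤ Fintype.card ι) : A.det ≤ 1 := by
  rw [hA.isHermitian.det_eq_prod_eigenvalues]
  rw [hA.isHermitian.trace_eq_sum_eigenvalues] at htr
  simp only [RCLike.ofReal_real_eq_id, id_eq] at htr ⊢
  calc ∏ i, hA.isHermitian.eigenvalues i
      ≤ ∏ i, Real.exp (hA.isHermitian.eigenvalues i - 1) :=
        Finset.prod_le_prod (fun i _ => hA.eigenvalues_nonneg i) fun i _ => by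
          linarith [Real.add_one_le_exp (hA.isHermitian.eigenvalues i - 1)]
    _ = Real.exp (∑ i, hA.isHermitian.eigenvalues i - Fintype.card ι) := by
        rw [← Real.exp_sum, Finset.sum_sub_distrib]
        simp
    _ ≤ 1 := Real.exp_le_one_iff.2 (by linarith)

/-- Hadamard's determinant inequality, with upper bounds on the diagonal entries. -/
lemma det_le_prod_of_diag_le {ι : Type*} [Fintype ι] [DecidableEq ι] {A : Matrix ι ι ℝ}
    (hA : A.PosSemidef) {d : ι → ℝ} (hd : ∀ i, 0 < d i) (hAd : ∀ i, A i i ≤ d i) :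
    A.det ≤ ∏ i, d i := by
  -- Rescale to a matrix with diagonal entries `A i i / d i ≤ 1`.
  let C : Matrix ι ι ℝ := Matrix.diagonal fun i => (√(d i))⁻¹
  have hC : C.conjTranspose = C := by simp [C]
  have hB : (C * A * C).PosSemidef := by
    have h := hA.conjTranspose_mul_mul_same C
    rwa [hC] at h
  have htr : (C * A * C).trace ≤ Fintype.card ι := by
    calc (C * A * C).trace ≤ ∑ _i : ι, (1 : ℝ) := Finset.sum_le_sum fun i _ => by
          rw [Matrix.diag_apply, Matrix.mul_diagonal, Matrix.diagonal_mul]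
          have hs : √(d i) * √(d i) = d i := Real.mul_self_sqrt (hd i).le
          have hs0 : 0 < √(d i) := Real.sqrt_pos.2 (hd i)
          rw [show (√(d i))⁻¹ * A i i * (√(d i))⁻¹ = A i i / (√(d i) * √(d i)) by
            field_simp, hs, div_le_one (hd i)]
          exact hAd i
      _ = _ := by simp
  have h := det_le_one_of_trace_le hB htr
  have hprod : C.det * C.det = (∏ i, d i)⁻¹ := by
    rw [Matrix.det_diagonal, ← Finset.prod_mul_distrib, ← Finset.prod_inv_distrib]
    exact Finset.prod_congr rfl fun i _ => by
      rw [← mul_inv, Real.mul_self_sqrt (hd i).le]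
  have hpos : 0 < ∏ i, d i := Finset.prod_pos fun i _ => hd i
  rw [Matrix.det_mul, Matrix.det_mul, mul_right_comm, hprod, inv_mul_le_iff₀ hpos, mul_one] at h
  exact h

lemma distMatrix_mem_feasible (hK : K = Matrix.diagonal fun i => K i i) {DX : Fin L → ℝ≥0}
    (hDX : ∀ i, (DX i : ℝ) ≤ K i i) : distMatrix DX ∈ feasible K DX := by
  refine ⟨Matrix.posSemidef_diagonal_iff.2 fun i => (DX i).2, ?_, fun i => ?_⟩
  · rw [hK, distMatrix, Matrix.diagonal_sub]
    exact Matrix.posSemidef_diagonal_iff.2 fun i => by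
      simpa using hDX i
  · simp [distMatrix]

lemma Qfun_nonneg (x : ℝ) : 0 ≤ Qfun x := measureReal_nonneg

lemma pe_mono {Γ Γ' : Matrix (Fin L) (Fin L) ℝ} (h0 : 0 ≤ Γ.trace) (h : Γ.trace ≤ Γ'.trace) :
    pe K Γ ≤ pe K Γ' := by
  refine min_le_min le_rfl (ciInf_mono ⟨0, ?_⟩ fun α => ?_)
  · rintro _ ⟨α, rfl⟩
    have := Qfun_nonneg (L * α / √K.trace)
    positivity
  · gcongr

/-- Among feasible matrices `diag(DX)` has the largest trace and, by Hadamard's inequality, the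
largest determinant, so it minimises the objective. -/
lemma objective_distMatrix_le (hM : 2 ≤ M) (hK : K.PosDef) (DS : ℝ≥0) {DX : Fin L → ℝ≥0}
    {Γ : Matrix (Fin L) (Fin L) ℝ} (hΓ : Γ ∈ feasible K DX) :
    objective ω K DS (distMatrix DX) ≤ objective ω K DS Γ := by
  obtain ⟨hΓ0, -, hΓd⟩ := hΓ
  by_cases hdet : Γ.det = 0
  · simp [objective, hdet]
  have hpd : Γ.PosDef := hΓ0.posDef_iff_det_ne_zero.2 hdet
  have hd : ∀ i, (0 : ℝ) < DX i := fun i => hpd.diag_pos.trans_le (hΓd i)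
  have hprod : 0 < (distMatrix DX).det := by
    rw [det_distMatrix]; exact Finset.prod_pos fun i _ => hd i
  have hdetle : Γ.det ≤ (distMatrix DX).det := by
    rw [det_distMatrix]; exact det_le_prod_of_diag_le hΓ0 hd hΓd
  have htr : Γ.trace ≤ (distMatrix DX).trace := by
    rw [trace_distMatrix]; exact Finset.sum_le_sum fun i _ => hΓd i
  have hM1 : (1 : ℝ) ≤ (M : ℝ) - 1 := by
    have : (2 : ℝ) ≤ M := by exact_mod_cast hM
    linarith
  have hβ : beta M K DS Γ ≤ beta M K DS (distMatrix DX) := by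
    refine min_le_min le_rfl (add_le_add le_rfl (mul_le_mul_of_nonneg_left
      (pe_mono hΓ0.trace_nonneg htr) (Real.logb_nonneg one_lt_two hM1)))
  have hlog : Real.logb 2 (K.det / (distMatrix DX).det) ≤ Real.logb 2 (K.det / Γ.det) :=
    Real.logb_le_logb_of_le one_lt_two (div_pos hK.det_pos hprod)
      (div_le_div_of_nonneg_left hK.det_pos.le hpd.det_pos hdetle)
  rw [objective, objective, if_neg hdet, if_neg hprod.ne']
  exact_mod_cast (by linarith)

lemma logb_det_div_distMatrix (hKdiag : K = Matrix.diagonal fun i => K i i)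
    (hK : K.PosDef) {DX : Fin L → ℝ≥0} (hd : ∀ i, DX i ≠ 0) :
    1 / 2 * Real.logb 2 (K.det / (distMatrix DX).det)
      = ∑ i, 1 / 2 * Real.logb 2 (K i i / DX i) := by
  have hdet : K.det = ∏ i, K i i := by
    conv_lhs => rw [hKdiag]
    exact Matrix.det_diagonal
  rw [hdet, det_distMatrix, ← Finset.prod_div_distrib, Real.logb_prod, Finset.mul_sum]
  intro i _
  have : (DX i : ℝ) ≠ 0 := by exact_mod_cast hd i
  exact div_ne_zero hK.diag_pos.ne' this

/-- The converse evaluated at `diag(DX)` when all distortions are positive. -/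
lemma Code.objective_distMatrix_le_sumRate (c : Code L M k) (hL : 1 ≤ L) (hM : 2 ≤ M)
    (hk : 1 ≤ k) (hω : ∀ s, 0 ≤ ω s) (hω1 : ∑ s, ω s = 1) (hK : K.PosDef)
    (hind : CondIndepObs M K) {DS : ℝ≥0} {DX : Fin L → ℝ≥0} (hd : ∀ i, DX i ≠ 0)
    (hS : c.semDist ω K ≤ DS) (hdist : ∀ i, c.obsDist ω K i ≤ DX i) :
    objective ω K DS (distMatrix DX) ≤ (c.sumRate : EReal) := by
  have hKdiag := eq_diagonal_of_condIndepObs (by omega : 0 < M) hK.posSemidef hind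
  have hdet : (distMatrix DX).det ≠ 0 := by
    rw [det_distMatrix]
    exact Finset.prod_ne_zero_iff.2 fun i _ => by exact_mod_cast hd i
  have := isProbabilityMeasure_blockLaw (K := K) k hω hω1
  have hk0 : (0 : ℝ) < k := by exact_mod_cast hk
  rw [objective, if_neg hdet, logb_det_div_distMatrix hKdiag hK hd]
  refine EReal.coe_le_coe_iff.2 ?_
  obtain ⟨f, hf⟩ := exists_nearest_label (by omega : 0 < M)
  have hp : ∑ j, (blockLaw k ω K).real
      {z | (z j).1 ≠ f ((∑ i, c.decX i (c.message z) j) / L)} ≤ k * pe K (distMatrix DX) := by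
    rw [← div_le_iff₀' hk0]
    have : Nonempty (Set.Ioo (0 : ℝ) (1 / 2)) := ⟨⟨1 / 4, by norm_num, by norm_num⟩⟩
    refine le_min ?_ (le_ciInf fun α => ?_)
    · rw [div_le_one hk0]
      calc _ ≤ ∑ _j : Fin k, (1 : ℝ) := Finset.sum_le_sum fun j _ => measureReal_le_one
        _ = k := by simp
    · rw [div_le_iff₀' hk0, trace_distMatrix]
      exact c.sum_error_le hL hk hω hω1 hK hind hdist hf α.2.2
  have h1 := c.sumRate_ge_of_semDist hk hω hω1 hK hind hd hdist hS
  have h2 := c.sumRate_ge_of_error hM hk hω hω1 hK hind hd hdist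
    (fun m j => f ((∑ i, c.decX i m j) / L)) hp
  rcases min_choice (DS : ℝ) (1 + Real.logb 2 ((M : ℝ) - 1) * pe K (distMatrix DX)) with h | h
  · rw [beta, h]; exact h1
  · rw [beta, h]; exact h2

/-- A finite-rate code cannot reconstruct a nondegenerate Gaussian observation exactly: the
converse may be applied with an arbitrarily small positive distortion in that coordinate. -/
lemma Code.distortion_ne_zero (c : Code L M k) (hk : 1 ≤ k) (hω : ∀ s, 0 ≤ ω s)
    (hω1 : ∑ s, ω s = 1) (hK : K.PosDef) (hind : CondIndepObs M K) {DS : ℝ≥0} {DX : Fin L → ℝ≥0}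
    (hS : c.semDist ω K ≤ DS) (hdist : ∀ i, c.obsDist ω K i ≤ DX i) (i₀ : Fin L) :
    DX i₀ ≠ 0 := by
  intro h0
  have hK0 : 0 < K i₀ i₀ := hK.diag_pos
  let R : ℝ := ∑ i ∈ Finset.univ.erase i₀, 1 / 2 * Real.logb 2 (K i i / (DX i + 1 : ℝ≥0))
  let t : ℝ := 2 * (c.sumRate - entropy ω + DS - R + 1)
  -- The distortion of coordinate `i₀` is relaxed to `ε`, chosen so that `logb 2 (K i₀ i₀ / ε) = t`.
  let ε : ℝ≥0 := ⟨K i₀ i₀ * 2 ^ (-t), by positivity⟩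
  have hεpos : (0 : ℝ) < ε := mul_pos hK0 (by positivity)
  let d : Fin L → ℝ≥0 := fun i => if i = i₀ then ε else DX i + 1
  have hd : ∀ i, d i ≠ 0 := by
    intro i
    simp only [d]
    split_ifs
    · exact (NNReal.coe_pos.1 hεpos).ne'
    · positivity
  have hdd : ∀ i, c.obsDist ω K i ≤ d i := by
    intro i
    refine (hdist i).trans ?_
    rw [ENNReal.coe_le_coe]
    simp only [d]
    split_ifs with h
    · rw [h, h0]; exact zero_le
    · exact le_self_add
  have h := c.sumRate_ge_of_semDist hk hω hω1 hK hind hd hdd hS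
  have hlog : Real.logb 2 (K i₀ i₀ / d i₀) = t := by
    have : K i₀ i₀ / (d i₀ : ℝ) = 2 ^ t := by
      have hdε : (d i₀ : ℝ) = K i₀ i₀ * 2 ^ (-t) := by rw [show d i₀ = ε from if_pos rfl]; rfl
      rw [hdε, Real.rpow_neg zero_le_two]
      field_simp
    rw [this, Real.logb_rpow two_pos (by norm_num)]
  have hR : ∑ i ∈ Finset.univ.erase i₀, 1 / 2 * Real.logb 2 (K i i / d i) = R := by
    refine Finset.sum_congr rfl fun i hi => ?_
    simp [d, Finset.ne_of_mem_erase hi]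
  rw [← Finset.add_sum_erase _ _ (Finset.mem_univ i₀), hlog, hR] at h
  simp only [t] at h
  linarith

end OuterBound

end SemanticMT

theorem theorem2 {L M : ℕ} (hL : 1 ≤ L) (hM : 2 ≤ M)
    (ω : Fin M → ℝ) (hω_nonneg : ∀ s, 0 ≤ ω s) (hω_sum : ∑ s, ω s = 1)
    (K : Matrix (Fin L) (Fin L) ℝ) (hK : K.PosDef) (hind : SemanticMT.CondIndepObs M K)
    (DS : ℝ≥0) (DX : Fin L → ℝ≥0) (hDX : ∀ i, (DX i : ℝ) ≤ K i i) :
    IsLeast (SemanticMT.objective ω K DS '' SemanticMT.feasible K DX)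
        (SemanticMT.rateOut ω K DS DX) ∧
      SemanticMT.rateOut ω K DS DX ≤ SemanticMT.rateDistortion ω K DS DX := by
  have hKdiag := SemanticMT.eq_diagonal_of_condIndepObs (by omega : 0 < M) hK.posSemidef hind
  have hleast : IsLeast (SemanticMT.objective ω K DS '' SemanticMT.feasible K DX)
      (SemanticMT.objective ω K DS (SemanticMT.distMatrix DX)) :=
    ⟨⟨_, SemanticMT.distMatrix_mem_feasible hKdiag hDX, rfl⟩, by
      rintro _ ⟨Γ, hΓ, rfl⟩
      exact SemanticMT.objective_distMatrix_le hM hK DS hΓ⟩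
  have hout : SemanticMT.rateOut ω K DS DX
      = SemanticMT.objective ω K DS (SemanticMT.distMatrix DX) := hleast.csInf_eq
  rw [hout]
  refine ⟨hleast, le_sInf ?_⟩
  rintro _ ⟨k, hk, R, ⟨c, rfl, hS, hdist⟩, rfl⟩
  exact c.objective_distMatrix_le_sumRate hL hM hk hω_nonneg hω_sum hK hind
    (c.distortion_ne_zero hk hω_nonneg hω_sum hK hind hS hdist) hS hdist
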